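/- Let $V$ be a separable reflexive real Banach space and $H$ a separable real Hilbert space such that $V\subset H$ with continuous and dense inclusion, and identify $H\cong H^*\subset V^*$, so that $V\subset H\subset V^*$; write $\|\cdot\|_V$, $|\cdot|_H$ for the norms and $\langle\cdot,\cdot\rangle$ for the duality pairing of $V^*$ and $V$. Let $T>0$, $u_0\in H$, $B\in L^2([0,T];V^*)$, and let $A:V\to V^*$ be linear, bounded and coercive in the sense that there exist $\lambda,\alpha>0$ with $$2\langle Au,u\rangle+\alpha\|u\|_V^2\le\lambda|u|_H^2\qquad\text{for all }u\in V. \tag{H1}$$ Then there exists a unique $u\in L^2([0,T];V)\cap C([0,T];H)$ that is a weak solution of $$\partial_t u=Au+B,\qquad u|_{t=0}=u_0 .$$ Here $u\in L^2([0,T];V)$ is a weak solution of the equation if, as a $V^*$-valued function, it has a weak time derivative $\frac{d}{dt}u\in L^2([0,T];V^*)$, i.e. $\int_0^T\varphi'(t)\,u_t\,dt=-\int_0^T\varphi(t)\,\frac{d}{dt}u_t\,dt$ in $V^*$ for all $\varphi\in C_c^\infty((0,T);\mathbb R)$, and, for almost every $t\in[0,T]$, $\langle\frac{d}{dt}u_t,v\rangle=\langle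 Au_t,v\rangle+\langle B_t,v\rangle$ for all $v\in V$. That $u\in C([0,T];H)$ with $u|_{t=0}=u_0$ means that the class $u$ has a version that is continuous from $[0,T]$ to $H$ and equals $u_0$ at $t=0$. Uniqueness is in $L^2([0,T];V)$, i.e. up to equality for almost every $t$. -/

import Mathlib

open MeasureTheory Set
open scoped ENNReal ContDiff

/-- Lebesgue measure on the interval `[0,T]`. -/
noncomputable abbrev timeMeasure (T : ℝ) : Measure ℝ := volume.restrict (Icc 0 T)

/-- `L²([0,T];E)`, the space of (a.e. classes of) square integrable, strongly measurable functions
on `[0,T]` with values in `E`. -/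
abbrev L2Time (T : ℝ) (E : Type*) [NormedAddCommGroup E] : Type _ := Lp E 2 (timeMeasure T)

/-- A normed space is reflexive when the canonical map into its bidual is onto. -/
def IsReflexiveSpace (V : Type*) [NormedAddCommGroup V] [NormedSpace ℝ V] : Prop :=
  Function.Surjective (NormedSpace.inclusionInDoubleDual ℝ V)

section Triple

variable {V H : Type*} [NormedAddCommGroup V] [NormedSpace ℝ V]
  [NormedAddCommGroup H] [InnerProductSpace ℝ H]

/-- `ι : V → H` realises `V ⊂ H ≅ H* ⊂ V*`: it is a continuous injection with dense range
(density is what makes `H* → V*` injective). -/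
structure IsGelfandEmbedding (ι : V →L[ℝ] H) : Prop where
  injective : Function.Injective ι
  denseRange : DenseRange ι

/-- The inclusion `H ≅ H* ⊂ V*`, sending `h` to the functional `v ↦ ⟨h, v⟩_H`. -/
noncomputable def pivotToDual (ι : V →L[ℝ] H) : H →L[ℝ] StrongDual ℝ V :=
  (ContinuousLinearMap.precomp ℝ ι).comp (innerSL ℝ)

theorem pivotToDual_apply (ι : V →L[ℝ] H) (h : H) (v : V) :
    pivotToDual ι h v = inner ℝ h (ι v) := rfl

/-- Coercivity: there are `λ, α > 0` with `2⟨Au,u⟩ + α‖u‖_V² ≤ λ|u|_H²` for every `u ∈ V`. -/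
def IsCoerciveOperator (ι : V →L[ℝ] H) (A : V →L[ℝ] StrongDual ℝ V) : Prop :=
  ∃ lam α : ℝ, 0 < lam ∧ 0 < α ∧
    ∀ u : V, 2 * A u u + α * ‖u‖ ^ 2 ≤ lam * ‖ι u‖ ^ 2

end Triple

/-- `v` is the weak derivative in time on `(0,T)` of `u`, both being in `L¹([0,T];E)`. -/
def IsWeakTimeDerivative {E : Type*} [NormedAddCommGroup E] [NormedSpace ℝ E]
    (T : ℝ) (u v : ℝ → E) : Prop :=
  Integrable u (timeMeasure T) ∧ Integrable v (timeMeasure T) ∧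
    ∀ φ : ℝ → ℝ, ContDiff ℝ ∞ φ → HasCompactSupport φ → tsupport φ ⊆ Ioo 0 T →
      ∫ t, deriv φ t • u t ∂timeMeasure T = -∫ t, φ t • v t ∂timeMeasure T

section Solution

variable {V H : Type*} [NormedAddCommGroup V] [NormedSpace ℝ V]
  [NormedAddCommGroup H] [InnerProductSpace ℝ H]

/-- `u ∈ L²([0,T];V)` solves `∂ₜu = Au + B` weakly: seen as a `V*`-valued function, it has a weak
time derivative in `L²([0,T];V*)`, and the identity holds when tested against `v ∈ V`. -/
def IsWeakSolution (ι : V →L[ℝ] H) (A : V →L[ℝ] StrongDual ℝ V) (T : ℝ)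
    (B : L2Time T (StrongDual ℝ V)) (u : L2Time T V) : Prop :=
  ∃ du : L2Time T (StrongDual ℝ V),
    IsWeakTimeDerivative T (fun t => pivotToDual ι (ι (u t))) du ∧
      ∀ᵐ t ∂timeMeasure T, ∀ v : V, du t v = A (u t) v + B t v

/-- `u ∈ L²([0,T];V) ∩ C([0,T];H)` with `u|_{t=0} = u₀`: the class `u` has a version that is
continuous from `[0,T]` to `H`, and this version takes the value `u₀` at time `0`. -/
def IsContinuousFrom (ι : V →L[ℝ] H) (T : ℝ) (u₀ : H) (u : L2Time T V) : Prop :=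
  ∃ w : ℝ → H, ContinuousOn w (Icc 0 T) ∧ (∀ᵐ t ∂timeMeasure T, ι (u t) = w t) ∧ w 0 = u₀

end Solution

/-! Both halves rest on an energy argument, applied only to $V$-valued curves that are $C^1$ or
primitives of integrable functions, so that no chain rule for $|u|_H^2$ with $u'$ merely in $V^*$ is
needed.

Uniqueness. The difference $u$ of two solutions satisfies $u(t)=A\,U(t)$ in $V^*$, with
$U(t)=\int_0^t u$. As $U$ is a primitive in $V$, integration by parts gives
$|U(t)|^2=2\int_0^t\langle AU,U\rangle\le\lambda\int_0^t|U|^2$, and Gronwall forces $U=0$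
(`primitive_eq_zero_of_pivot_eq`).

Existence. Every $C^1$ curve in $V$ solves the problem for the data $(u(0),\,u'-Au)$ it produces. By
`energy_estimate` these data control the curve in $L^2(V)$ and $C(H)$, so the solution map extends
by continuity once such data are dense in $H\times L^2(V^*)$. Coercivity makes $V$ isomorphic to a
Hilbert space, so density means a trivial orthogonal complement. An element $(h,g)$ of it satisfies
the backward adjoint equation $g(t)=A^*\int_t^T g$; the uniqueness argument in reversed time gives
$g=0$, and density of $V$ in $H$ gives $h=0$ (`dense_map_fst_classicalGraph`). The weak formulation
and the initial condition then pass to limits. -/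

/-! ### Integration by parts for primitives, and the du Bois-Reymond lemma. -/

section Calculus

variable {E F G : Type*} [NormedAddCommGroup E] [NormedSpace ℝ E]
  [NormedAddCommGroup F] [NormedSpace ℝ F] [NormedAddCommGroup G] [NormedSpace ℝ G]

theorem integral_prod_bilin_lower_triangle [CompleteSpace F] [CompleteSpace G]
    (b : E →L[ℝ] F →L[ℝ] G) {T : ℝ} (hT : 0 ≤ T) {f : ℝ → E} {g : ℝ → F} (hf : IntegrableOn f (Ioc 0 T))
    (hg : IntegrableOn g (Ioc 0 T)) :
    ∫ z in {z : ℝ × ℝ | z.2 ≤ z.1}, b (f z.1) (g z.2)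
        ∂((volume.restrict (Ioc 0 T)).prod (volume.restrict (Ioc 0 T))) =
      ∫ t in (0)..T, b (f t) (∫ s in (0)..t, g s) := by
  have hm : MeasurableSet {z : ℝ × ℝ | z.2 ≤ z.1} := measurableSet_le measurable_snd measurable_fst
  have hi : Integrable (fun z : ℝ × ℝ ↦ b (f z.1) (g z.2))
      ((volume.restrict (Ioc 0 T)).prod (volume.restrict (Ioc 0 T))) :=
    hf.op_fst_snd (by fun_prop) ⟨‖b‖, b.le_opNorm₂⟩ hg
  rw [← integral_indicator hm, integral_prod _ (hi.indicator hm),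
    intervalIntegral.integral_of_le hT]
  refine setIntegral_congr_fun measurableSet_Ioc fun t ht ↦ ?_
  have h1 : ∀ s, indicator {z : ℝ × ℝ | z.2 ≤ z.1} (fun z ↦ b (f z.1) (g z.2)) (t, s) =
      (Iic t).indicator (fun s ↦ b (f t) (g s)) s := fun s ↦ by
    simp [indicator_apply]
  simp only [h1]
  rw [setIntegral_indicator measurableSet_Iic, Ioc_inter_Iic, min_eq_right ht.2,
    intervalIntegral.integral_of_le ht.1.le]
  exact ContinuousLinearMap.integral_comp_comm _ (hg.mono_set (Ioc_subset_Ioc_right ht.2))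

/-- Integration by parts for the primitives of two integrable functions. -/
theorem bilin_integral_eq_add [CompleteSpace E] [CompleteSpace F] [CompleteSpace G]
    (b : E →L[ℝ] F →L[ℝ] G) {T : ℝ}
    (hT : 0 ≤ T) {f : ℝ → E} {g : ℝ → F} (hf : IntegrableOn f (Ioc 0 T))
    (hg : IntegrableOn g (Ioc 0 T)) :
    b (∫ t in (0)..T, f t) (∫ t in (0)..T, g t) =
      (∫ t in (0)..T, b (f t) (∫ s in (0)..t, g s)) +
        ∫ t in (0)..T, b (∫ s in (0)..t, f s) (g t) := by
  have hm : MeasurableSet {z : ℝ × ℝ | z.2 ≤ z.1} := measurableSet_le measurable_snd measurable_fst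
  have hi : Integrable (fun z : ℝ × ℝ ↦ b (f z.1) (g z.2))
      ((volume.restrict (Ioc 0 T)).prod (volume.restrict (Ioc 0 T))) :=
    hf.op_fst_snd (by fun_prop) ⟨‖b‖, b.le_opNorm₂⟩ hg
  -- The product of the integrals is an integral over the square, cut along the diagonal; Fubini is
  -- used in opposite orders on the two triangles.
  rw [intervalIntegral.integral_of_le hT, intervalIntegral.integral_of_le hT,
    ← integral_prod_bilin b hf hg, ← integral_add_compl hm hi,
    integral_prod_bilin_lower_triangle b hT hf hg]
  congr 1
  rw [← integral_indicator hm.compl, integral_prod_symm _ (hi.indicator hm.compl),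
    intervalIntegral.integral_of_le hT]
  refine setIntegral_congr_fun measurableSet_Ioc fun t ht ↦ ?_
  have h1 : ∀ s, indicator {z : ℝ × ℝ | z.2 ≤ z.1}ᶜ (fun z ↦ b (f z.1) (g z.2)) (s, t) =
      (Iio t).indicator (fun s ↦ b.flip (g t) (f s)) s := fun s ↦ by
    simp [indicator_apply]
  have h2 : Ioc 0 T ∩ Iio t = Ioo 0 t := by
    ext s; simp only [mem_inter_iff, mem_Ioc, mem_Iio, mem_Ioo]
    exact ⟨fun h ↦ ⟨h.1.1, h.2⟩, fun h ↦ ⟨⟨h.1, h.2.le.trans ht.2⟩, h.2⟩⟩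
  simp only [h1]
  rw [setIntegral_indicator measurableSet_Iio, h2, intervalIntegral.integral_of_le ht.1.le,
    integral_Ioc_eq_integral_Ioo]
  rw [ContinuousLinearMap.integral_comp_comm]
  · rfl
  · exact hf.mono_set (Ioo_subset_Ioc_self.trans (Ioc_subset_Ioc_right ht.2))

/-- The lemma of du Bois-Reymond for vector-valued functions. -/
theorem exists_ae_eq_const_of_integral_deriv_smul_eq_zero [CompleteSpace E] {T : ℝ} (hT : 0 < T)
    {f : ℝ → E} (hf : IntegrableOn f (Icc 0 T))
    (h : ∀ φ : ℝ → ℝ, ContDiff ℝ ∞ φ → HasCompactSupport φ → tsupport φ ⊆ Ioo 0 T →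
      ∫ t, deriv φ t • f t ∂timeMeasure T = 0) :
    ∃ c : E, ∀ᵐ t ∂timeMeasure T, f t = c := by
  obtain ⟨θ, hθs, hθc, hθsub, hθ1⟩ : ∃ θ : ℝ → ℝ, ContDiff ℝ ∞ θ ∧ HasCompactSupport θ ∧
      tsupport θ ⊆ Ioo 0 T ∧ ∫ t, θ t = 1 := by
    -- Any outer radius below `T / 2` keeps the support inside the open interval.
    let β : ContDiffBump (T / 2) := ⟨T / 8, T / 4, by positivity, by linarith⟩
    refine ⟨β.normed volume, β.contDiff_normed, β.hasCompactSupport_normed, ?_,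
      β.integral_normed⟩
    rw [β.tsupport_normed_eq, Real.closedBall_eq_Icc]
    intro t ht
    have h1 : β.rOut = T / 4 := rfl
    rw [h1] at ht
    exact ⟨by linarith [ht.1], by linarith [ht.2]⟩
  set c : E := ∫ t, θ t • f t ∂timeMeasure T with hc
  refine ⟨c, ?_⟩
  have hint : ∀ ψ : ℝ → ℝ, Continuous ψ → ∀ g : ℝ → E, Integrable g (timeMeasure T) →
      Integrable (fun t ↦ ψ t • g t) (timeMeasure T) := fun ψ hψ g hg ↦
    IntegrableOn.continuousOn_smul hg hψ.continuousOn isCompact_Icc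
  have hsupp : ∀ ψ : ℝ → ℝ, tsupport ψ ⊆ Ioo 0 T → ∀ t, t ∉ Ioo 0 T → ψ t = 0 :=
    fun ψ hψ t ht ↦ image_eq_zero_of_notMem_tsupport fun h ↦ ht (hψ h)
  have key : ∀ ψ : ℝ → ℝ, ContDiff ℝ ∞ ψ → HasCompactSupport ψ → tsupport ψ ⊆ Ioo 0 T →
      ∫ t, ψ t • (f t - c) = 0 := by
    intro ψ hψs hψc hψsub
    set I : ℝ := ∫ t, ψ t with hI
    -- Subtracting `I * θ` makes the mean zero, so the primitive of `χ` is again compactly supported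
    -- and may be used in `h`.
    set χ : ℝ → ℝ := fun t ↦ ψ t - I * θ t with hχ
    have hχs : ContDiff ℝ ∞ χ := hψs.sub (contDiff_const.mul hθs)
    set φ : ℝ → ℝ := fun t ↦ ∫ s in (0)..t, χ s with hφ
    have hφd : ∀ t, HasDerivAt φ (χ t) t := fun t ↦
      (hχs.continuous.integral_hasStrictDerivAt 0 t).hasDerivAt
    have hφ' : deriv φ = χ := funext fun t ↦ (hφd t).deriv
    have hφs : ContDiff ℝ ∞ φ :=
      contDiff_infty_iff_deriv.2 ⟨fun t ↦ (hφd t).differentiableAt, hφ' ▸ hχs⟩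
    let K := tsupport ψ ∪ tsupport θ
    have hK : IsCompact K := hψc.isCompact.union hθc.isCompact
    have hKsub : K ⊆ Ioo 0 T := union_subset hψsub hθsub
    have hχK : ∀ t, t ∉ K → χ t = 0 := fun t ht ↦ by
      have h1 : ψ t = 0 := image_eq_zero_of_notMem_tsupport fun h ↦ ht (Or.inl h)
      have h2 : θ t = 0 := image_eq_zero_of_notMem_tsupport fun h ↦ ht (Or.inr h)
      simp [hχ, h1, h2]
    have hχI : ∫ t, χ t = 0 := by
      rw [hχ, integral_sub (hψs.continuous.integrable_of_hasCompactSupport hψc)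
        ((hθs.continuous.integrable_of_hasCompactSupport hθc).const_mul I),
        integral_const_mul, hθ1]
      simp [hI]
    -- The primitive need not vanish in gaps of `K`, so its support is controlled by an interval
    -- containing `K`.
    obtain ⟨a, b, ha, hb, hab, hKab⟩ : ∃ a b : ℝ, 0 < a ∧ b < T ∧ a ≤ b ∧ K ⊆ Icc a b := by
      rcases K.eq_empty_or_nonempty with hKe | hKn
      · exact ⟨T / 2, T / 2, by linarith, by linarith, le_rfl, by simp [hKe]⟩
      · refine ⟨sInf K, sSup K, (hKsub (hK.sInf_mem hKn)).1, (hKsub (hK.sSup_mem hKn)).2,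
          csInf_le_csSup hKn hK.bddBelow hK.bddAbove,
          fun t ht ↦ ⟨csInf_le hK.bddBelow ht, le_csSup hK.bddAbove ht⟩⟩
    have hφ0 : ∀ t, t ∉ Icc a b → φ t = 0 := by
      intro t ht
      rcases lt_or_ge t a with h1 | h1
      · refine intervalIntegral.integral_zero_ae (Filter.Eventually.of_forall fun s hs ↦ ?_)
        refine hχK s fun hsK ↦ ?_
        have h3 := (hKab hsK).1
        rcases le_max_iff.1 hs.2 with h4 | h4 <;> linarith
      · have h2 : b < t := not_le.1 fun h2 ↦ ht ⟨h1, h2⟩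
        have h3 : ∫ s in (0)..t, χ s = ∫ s, χ s := by
          rw [intervalIntegral.integral_of_le (by linarith)]
          refine setIntegral_eq_integral_of_forall_compl_eq_zero fun s hs ↦ hχK s fun hsK ↦ ?_
          exact hs ⟨by linarith [(hKab hsK).1], by linarith [(hKab hsK).2]⟩
        rw [hφ]
        exact h3.trans hχI
    have hts : tsupport φ ⊆ Icc a b :=
      closure_minimal (fun t ht ↦ by_contra fun h ↦ ht (hφ0 t h)) isClosed_Icc
    have h0 := h φ hφs (HasCompactSupport.of_support_subset_isCompact isCompact_Icc
      ((subset_tsupport φ).trans hts))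
      (hts.trans fun t ht ↦ ⟨by linarith [ht.1], by linarith [ht.2]⟩)
    rw [hφ'] at h0
    have h1 : ∫ t, ψ t • (f t - c) = ∫ t, ψ t • (f t - c) ∂timeMeasure T :=
      (setIntegral_eq_integral_of_forall_compl_eq_zero fun t ht ↦ by
        rw [hsupp ψ hψsub t fun h ↦ ht (Ioo_subset_Icc_self h), zero_smul]).symm
    have h2 : ∫ t, ψ t ∂timeMeasure T = I :=
      setIntegral_eq_integral_of_forall_compl_eq_zero fun t ht ↦
        hsupp ψ hψsub t fun h ↦ ht (Ioo_subset_Icc_self h)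
    have h3 : ∫ t, ψ t • f t ∂timeMeasure T = I • c := by
      have : ∀ t, χ t • f t = ψ t • f t - I • θ t • f t := fun t ↦ by
        rw [hχ, sub_smul, mul_smul]
      simp only [this] at h0
      rw [integral_sub (hint ψ hψs.continuous f hf)
        (show Integrable (fun t ↦ I • θ t • f t) _ from (hint θ hθs.continuous f hf).smul I),
        integral_smul, ← hc, sub_eq_zero] at h0
      exact h0
    rw [h1]
    simp only [smul_sub]
    rw [integral_sub (hint ψ hψs.continuous f hf)
      (hint ψ hψs.continuous _ (integrable_const c)), h3, integral_smul_const, h2, sub_self]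
  have hae := isOpen_Ioo.ae_eq_zero_of_integral_contDiff_smul_eq_zero (μ := volume)
    (f := fun t ↦ f t - c) (U := Ioo 0 T)
    ((hf.mono_set Ioo_subset_Icc_self).sub
      (integrableOn_const (by simp))).locallyIntegrableOn key
  have : timeMeasure T = volume.restrict (Ioo 0 T) := Measure.restrict_congr_set Ioo_ae_eq_Icc.symm
  rw [this, ae_restrict_iff' measurableSet_Ioo]
  filter_upwards [hae] with t ht htT
  exact sub_eq_zero.1 (ht htT)

end Calculus

/-! ### Uniqueness through the energy of the time primitive. -/

section Uniqueness

variable {V H : Type*} [NormedAddCommGroup V] [NormedSpace ℝ V]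
  [NormedAddCommGroup H] [InnerProductSpace ℝ H]

theorem IsGelfandEmbedding.pivotToDual_injective {ι : V →L[ℝ] H} (hι : IsGelfandEmbedding ι) :
    Function.Injective (pivotToDual ι) := by
  refine (injective_iff_map_eq_zero _).2 fun h hh ↦ ?_
  refine hι.denseRange.eq_zero_of_inner_left ℝ fun v ↦ ?_
  rw [← pivotToDual_apply, hh, zero_apply]

/-- The equation enters integrated once in time: the primitive of `u` has its derivative in `V`, not
just in the dual, so its energy identity is plain integration by parts, and Gronwall finishes. -/
theorem primitive_eq_zero_of_pivot_eq [CompleteSpace V] [CompleteSpace H] {ι : V →L[ℝ] H}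
    (hι : Function.Injective ι) {A : V →L[ℝ] StrongDual ℝ V} (hA : IsCoerciveOperator ι A)
    {T : ℝ} {u : ℝ → V} (hu : Integrable u)
    (h : ∀ᵐ t ∂timeMeasure T, pivotToDual ι (ι (u t)) = A (∫ s in (0)..t, u s))
    {t : ℝ} (ht : t ∈ Icc 0 T) : ∫ s in (0)..t, u s = 0 := by
  obtain ⟨lam, α, hlam, hα, hco⟩ := hA
  set U : ℝ → V := fun t ↦ ∫ s in (0)..t, u s with hU
  have hUc : Continuous U :=
    intervalIntegral.continuous_primitive (fun a b ↦ hu.intervalIntegrable) 0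
  have hyc : Continuous fun t ↦ ‖ι (U t)‖ ^ 2 := by fun_prop
  have hιU : ∀ t, ∫ s in (0)..t, ι (u s) = ι (U t) := fun t ↦
    ι.intervalIntegral_comp_comm hu.intervalIntegrable
  have energy : ∀ t ∈ Icc 0 T, ‖ι (U t)‖ ^ 2 ≤ lam * ∫ s in (0)..t, ‖ι (U s)‖ ^ 2 := by
    intro t ht
    have hιu : IntegrableOn (fun s ↦ ι (u s)) (Ioc 0 t) := (ι.integrable_comp hu).integrableOn
    have h1 := bilin_integral_eq_add (innerSL ℝ) ht.1 hιu hιu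
    simp only [hιU] at h1
    change inner ℝ (ι (U t)) (ι (U t)) = (∫ s in (0)..t, inner ℝ (ι (u s)) (ι (U s))) +
      ∫ s in (0)..t, inner ℝ (ι (U s)) (ι (u s)) at h1
    have h2 : ∀ s ∈ Ioc 0 t, s ∈ Icc 0 T := fun s hs ↦ ⟨hs.1.le, hs.2.trans ht.2⟩
    have h3 : ∀ᵐ s ∂volume.restrict (Ioc 0 t), inner ℝ (ι (u s)) (ι (U s)) = A (U s) (U s) := by
      filter_upwards [ae_restrict_of_ae_restrict_of_subset h2 h] with s hs
      rw [← pivotToDual_apply, hs]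
    have h4 : ∫ s in (0)..t, inner ℝ (ι (u s)) (ι (U s)) = ∫ s in (0)..t, A (U s) (U s) := by
      rw [intervalIntegral.integral_of_le ht.1, intervalIntegral.integral_of_le ht.1]
      exact integral_congr_ae h3
    have h5 : ∫ s in (0)..t, inner ℝ (ι (U s)) (ι (u s)) = ∫ s in (0)..t, A (U s) (U s) := by
      rw [← h4]
      simp only [real_inner_comm]
    rw [h4, h5, real_inner_self_eq_norm_sq, ← two_mul] at h1
    rw [h1, ← intervalIntegral.integral_const_mul, ← intervalIntegral.integral_const_mul]
    refine intervalIntegral.integral_mono_on ht.1 (Continuous.intervalIntegrable (by fun_prop) _ _)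
      (Continuous.intervalIntegrable (by fun_prop) _ _) fun s _ ↦ ?_
    nlinarith [hco (U s), sq_nonneg ‖U s‖]
  have hYd : ∀ t, HasDerivAt (fun t ↦ ∫ s in (0)..t, ‖ι (U s)‖ ^ 2) (‖ι (U t)‖ ^ 2) t := fun t ↦
    (hyc.integral_hasStrictDerivAt 0 t).hasDerivAt
  -- Gronwall is applied to the integral of the energy, which is differentiable everywhere because
  -- the energy is continuous.
  have hY := eq_zero_of_abs_deriv_le_mul_abs_self_of_eq_zero_right
    (f := fun t ↦ ∫ s in (0)..t, ‖ι (U s)‖ ^ 2) (K := lam) (a := 0) (b := T)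
    (fun t _ ↦ (hYd t).continuousAt.continuousWithinAt)
    (fun t _ ↦ (hYd t).hasDerivWithinAt) (by simp) (fun t ht ↦ by
      rw [Real.norm_of_nonneg (sq_nonneg _), Real.norm_of_nonneg
        (intervalIntegral.integral_nonneg ht.1 fun s _ ↦ sq_nonneg _)]
      exact energy t ⟨ht.1, ht.2.le⟩) t ht
  have h6 := energy t ht
  rw [hY, mul_zero] at h6
  have h7 : ι (U t) = 0 := by
    rw [← norm_eq_zero]
    exact pow_eq_zero_iff two_ne_zero |>.1 (le_antisymm h6 (sq_nonneg _))
  exact hι (by rw [h7, map_zero])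

/-- An integrable function `u` with `u = A ∫₀ᵗ u` in the dual vanishes almost everywhere. -/
theorem ae_eq_zero_of_pivot_eq_primitive [CompleteSpace V] [CompleteSpace H] {ι : V →L[ℝ] H}
    (hι : IsGelfandEmbedding ι) {A : V →L[ℝ] StrongDual ℝ V} (hA : IsCoerciveOperator ι A)
    {T : ℝ} {u : ℝ → V} (hu : Integrable u (timeMeasure T))
    (h : ∀ᵐ t ∂timeMeasure T, pivotToDual ι (ι (u t)) = A (∫ s in (0)..t, u s)) :
    ∀ᵐ t ∂timeMeasure T, u t = 0 := by
  -- Extension by zero gives integrability on the whole line without changing primitives on `[0,T]`.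
  set v : ℝ → V := (Icc 0 T).indicator u with hv
  have hvu : ∀ t ∈ Icc 0 T, v t = u t := fun t ht ↦ indicator_of_mem ht u
  have hprim : ∀ t ∈ Icc 0 T, ∫ s in (0)..t, v s = ∫ s in (0)..t, u s := fun t ht ↦ by
    refine intervalIntegral.integral_congr fun s hs ↦ hvu s ?_
    rw [uIcc_of_le ht.1] at hs
    exact ⟨hs.1, hs.2.trans ht.2⟩
  have hmem : ∀ᵐ t ∂timeMeasure T, t ∈ Icc 0 T := ae_restrict_mem measurableSet_Icc
  have hv0 : ∀ t ∈ Icc 0 T, ∫ s in (0)..t, v s = 0 := fun t ht ↦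
    primitive_eq_zero_of_pivot_eq (u := v) hι.injective hA
      ((integrable_indicator_iff measurableSet_Icc).2 hu)
      (by
        filter_upwards [h, hmem] with t ht htm
        rw [hvu t htm, hprim t htm, ht]) ht
  filter_upwards [h, hmem] with t ht htm
  rw [← hprim t htm, hv0 t htm, map_zero] at ht
  refine hι.injective (hι.pivotToDual_injective ?_)
  rw [ht, map_zero, map_zero]

theorem integrable_of_L2Time {E : Type*} [NormedAddCommGroup E] {T : ℝ} (u : L2Time T E) :
    Integrable u (timeMeasure T) :=
  (Lp.memLp u).integrable one_le_two

/-- A weak solution without source which starts from zero vanishes. -/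
theorem eq_zero_of_isWeakSolution_zero [CompleteSpace V] [CompleteSpace H] {ι : V →L[ℝ] H}
    (hι : IsGelfandEmbedding ι) {A : V →L[ℝ] StrongDual ℝ V} (hA : IsCoerciveOperator ι A)
    {T : ℝ} (hT : 0 < T) {u : L2Time T V} (hu : IsWeakSolution ι A T 0 u)
    (hu0 : IsContinuousFrom ι T 0 u) : u = 0 := by
  obtain ⟨du, ⟨hi, hdi, hw⟩, heq⟩ := hu
  obtain ⟨w, hwc, hwu, hw0⟩ := hu0
  have hui := integrable_of_L2Time u
  have heq' : ∀ᵐ t ∂timeMeasure T, du t = A (u t) := by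
    filter_upwards [heq, Lp.coeFn_zero (StrongDual ℝ V) 2 (timeMeasure T)] with t ht h0
    ext v
    rw [ht v, h0]
    simp
  have hAu : Integrable (fun t ↦ A (u t)) (timeMeasure T) := A.integrable_comp hui
  have hFc : ContinuousOn (fun t ↦ ∫ s in (0)..t, A (u s)) (Icc 0 T) := by
    have := intervalIntegral.continuousOn_primitive_interval (μ := volume) (a := 0) (b := T)
      (f := fun s ↦ A (u s)) (by rw [uIcc_of_le hT.le]; exact hAu)
    rwa [uIcc_of_le hT.le] at this
  have hFi : Integrable (fun t ↦ ∫ s in (0)..t, A (u s)) (timeMeasure T) :=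
    hFc.integrableOn_Icc
  -- The difference between `u` and the primitive of `A u` has zero weak derivative, hence is
  -- constant.
  obtain ⟨c, hc⟩ := exists_ae_eq_const_of_integral_deriv_smul_eq_zero hT
    (f := fun t ↦ pivotToDual ι (ι (u t)) - ∫ s in (0)..t, A (u s)) (hi.sub hFi) (by
      intro φ hφ hφc hφs
      have hd : Continuous (deriv φ) := hφ.continuous_deriv (by simp)
      have hφ0 : φ 0 = 0 := image_eq_zero_of_notMem_tsupport fun h ↦ lt_irrefl _ (hφs h).1
      have hφT : φ T = 0 := image_eq_zero_of_notMem_tsupport fun h ↦ lt_irrefl _ (hφs h).2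
      have hφp : ∀ t, ∫ s in (0)..t, deriv φ s = φ t := fun t ↦ by
        rw [intervalIntegral.integral_deriv_eq_sub
          (fun s _ ↦ (hφ.differentiable (by simp)).differentiableAt)
          (hd.intervalIntegrable _ _), hφ0, sub_zero]
      have hsub : Integrable (fun t ↦ deriv φ t • pivotToDual ι (ι (u t))) (timeMeasure T) :=
        IntegrableOn.continuousOn_smul hi hd.continuousOn isCompact_Icc
      have hsub' : Integrable (fun t ↦ deriv φ t • ∫ s in (0)..t, A (u s)) (timeMeasure T) :=
        IntegrableOn.continuousOn_smul hFi hd.continuousOn isCompact_Icc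
      have h1 := bilin_integral_eq_add (ContinuousLinearMap.lsmul ℝ ℝ) hT.le
        (f := deriv φ) (g := fun t ↦ A (u t)) (hd.continuousOn.integrableOn_Icc.mono_set
          Ioc_subset_Icc_self) (IntegrableOn.mono_set hAu Ioc_subset_Icc_self)
      simp only [ContinuousLinearMap.lsmul_apply, hφp, hφT, zero_smul] at h1
      rw [intervalIntegral.integral_of_le hT.le, intervalIntegral.integral_of_le hT.le,
        ← integral_Icc_eq_integral_Ioc, ← integral_Icc_eq_integral_Ioc] at h1
      simp only [smul_sub]
      rw [integral_sub hsub hsub', hw φ hφ hφc hφs, eq_neg_of_add_eq_zero_left h1.symm]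
      rw [neg_sub_neg, sub_eq_zero]
      refine integral_congr_ae ?_
      filter_upwards [heq'] with t ht
      rw [ht])
  -- Continuity of `w` upgrades the identity from almost every time to every time, so that it can be
  -- read at `0`.
  have hc' : EqOn (fun t ↦ pivotToDual ι (w t) - ∫ s in (0)..t, A (u s)) (fun _ ↦ c)
      (Icc 0 T) := by
    refine Measure.eqOn_Icc_of_ae_eq volume hT.ne ?_
      (((pivotToDual ι).continuous.comp_continuousOn hwc).sub hFc) continuousOn_const
    filter_upwards [hc, hwu] with t ht htw
    rw [← htw, ht]
  have hc0 : c = 0 := by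
    have := hc' (left_mem_Icc.2 hT.le)
    simpa [hw0] using this.symm
  have := ae_eq_zero_of_pivot_eq_primitive hι hA hui (by
    filter_upwards [hc, ae_restrict_mem measurableSet_Icc] with t ht htm
    rw [hc0, sub_eq_zero] at ht
    rw [ht]
    refine A.intervalIntegral_comp_comm ?_
    rw [intervalIntegrable_iff_integrableOn_Ioc_of_le htm.1]
    exact IntegrableOn.mono_set hui fun s hs ↦ ⟨hs.1.le, hs.2.trans htm.2⟩)
  exact (Lp.eq_zero_iff_ae_eq_zero).2 this

theorem IsWeakSolution.sub {ι : V →L[ℝ] H} {A : V →L[ℝ] StrongDual ℝ V} {T : ℝ}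
    {B B' : L2Time T (StrongDual ℝ V)} {u u' : L2Time T V} (hu : IsWeakSolution ι A T B u)
    (hu' : IsWeakSolution ι A T B' u') : IsWeakSolution ι A T (B - B') (u - u') := by
  obtain ⟨du, ⟨hi, hdi, hw⟩, heq⟩ := hu
  obtain ⟨du', ⟨hi', hdi', hw'⟩, heq'⟩ := hu'
  have h1 : (fun t ↦ pivotToDual ι (ι (u t)) - pivotToDual ι (ι (u' t))) =ᵐ[timeMeasure T]
      fun t ↦ pivotToDual ι (ι ((u - u' : L2Time T V) t)) := by
    filter_upwards [Lp.coeFn_sub u u'] with t ht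
    rw [ht, Pi.sub_apply, map_sub, map_sub]
  refine ⟨du - du', ⟨(hi.sub hi').congr h1, integrable_of_L2Time _, fun φ hφ hφc hφs ↦ ?_⟩, ?_⟩
  · have hd : Continuous (deriv φ) := hφ.continuous_deriv (by simp)
    have e1 : ∫ t, deriv φ t • pivotToDual ι (ι ((u - u' : L2Time T V) t)) ∂timeMeasure T =
        ∫ t, (deriv φ t • pivotToDual ι (ι (u t)) - deriv φ t • pivotToDual ι (ι (u' t)))
          ∂timeMeasure T := integral_congr_ae (by
      filter_upwards [h1] with t ht
      rw [← ht, smul_sub])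
    have e2 : ∫ t, φ t • (du - du' : L2Time T (StrongDual ℝ V)) t ∂timeMeasure T =
        ∫ t, (φ t • du t - φ t • du' t) ∂timeMeasure T := integral_congr_ae (by
      filter_upwards [Lp.coeFn_sub du du'] with t ht
      rw [ht, Pi.sub_apply, smul_sub])
    rw [e1, e2, integral_sub (IntegrableOn.continuousOn_smul hi hd.continuousOn isCompact_Icc)
      (IntegrableOn.continuousOn_smul hi' hd.continuousOn isCompact_Icc),
      integral_sub (IntegrableOn.continuousOn_smul hdi hφ.continuous.continuousOn isCompact_Icc)
      (IntegrableOn.continuousOn_smul hdi' hφ.continuous.continuousOn isCompact_Icc),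
      hw φ hφ hφc hφs, hw' φ hφ hφc hφs]
    abel
  · filter_upwards [heq, heq', Lp.coeFn_sub u u', Lp.coeFn_sub du du', Lp.coeFn_sub B B'] with
      t h2 h2' h3 h4 h5 v
    rw [h3, h4, h5]
    simp only [Pi.sub_apply, sub_apply, map_sub, h2, h2']
    ring

theorem IsContinuousFrom.sub {ι : V →L[ℝ] H} {T : ℝ} {u₀ u₀' : H} {u u' : L2Time T V}
    (hu : IsContinuousFrom ι T u₀ u) (hu' : IsContinuousFrom ι T u₀' u') :
    IsContinuousFrom ι T (u₀ - u₀') (u - u') := by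
  obtain ⟨w, hc, hw, h0⟩ := hu
  obtain ⟨w', hc', hw', h0'⟩ := hu'
  refine ⟨fun t ↦ w t - w' t, hc.sub hc', ?_, by simp only [h0, h0']⟩
  filter_upwards [hw, hw', Lp.coeFn_sub u u'] with t h1 h2 h3
  rw [h3, Pi.sub_apply, map_sub, h1, h2]

end Uniqueness

/-! ### The Hilbert structure that coercivity induces on `V`. -/

/-- A copy of a vector space which carries no norm. -/
def HilbertCopy (V : Type*) := V

instance (V : Type*) [AddCommGroup V] : AddCommGroup (HilbertCopy V) :=
  inferInstanceAs (AddCommGroup V)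

instance (V : Type*) [AddCommGroup V] [Module ℝ V] : Module ℝ (HilbertCopy V) :=
  inferInstanceAs (Module ℝ V)

section Hilbert

universe u

/-- A Banach space with a bounded symmetric coercive bilinear form is isomorphic to a Hilbert
space. -/
theorem exists_hilbert_equiv_of_coercive {V : Type u} [NormedAddCommGroup V] [NormedSpace ℝ V]
    [CompleteSpace V] (b : V →L[ℝ] V →L[ℝ] ℝ) (hb : ∀ x y, b x y = b y x) {c : ℝ} (hc : 0 < c)
    (hbc : ∀ x, c * ‖x‖ ^ 2 ≤ b x x) :
    ∃ (W : Type u) (_ : NormedAddCommGroup W) (_ : InnerProductSpace ℝ W),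
      CompleteSpace W ∧ Nonempty (V ≃L[ℝ] W) := by
  let core : InnerProductSpace.Core ℝ (HilbertCopy V) :=
    { inner := fun x y ↦ b (show V from x) (show V from y)
      conj_inner_symm := fun x y ↦ hb y x
      re_inner_nonneg := fun x ↦ (mul_nonneg hc.le (sq_nonneg _)).trans (hbc x)
      add_left := fun x y z ↦ by
        change b ((show V from x) + (show V from y)) _ = _
        rw [map_add]; rfl
      smul_left := fun x y r ↦ by
        change b (r • (show V from x)) _ = _
        rw [map_smul]; rfl
      definite := fun x hx ↦ by
        have h1 : c * ‖(show V from x)‖ ^ 2 ≤ 0 := (hbc x).trans hx.le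
        have h2 : ‖(show V from x)‖ ^ 2 ≤ 0 := by
          by_contra h
          exact absurd h1 (not_le.2 (mul_pos hc (not_le.1 h)))
        exact norm_eq_zero.1 (pow_eq_zero_iff two_ne_zero |>.1 (le_antisymm h2 (sq_nonneg _))) }
  let _ : NormedAddCommGroup (HilbertCopy V) := core.toNormedAddCommGroup
  let _ : InnerProductSpace ℝ (HilbertCopy V) := InnerProductSpace.ofCore core.toCore
  have hnorm : ∀ x : V, ‖(show HilbertCopy V from x)‖ ^ 2 = b x x := fun x ↦ by
    rw [← real_inner_self_eq_norm_sq]; rfl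
  let l : V ≃ₗ[ℝ] HilbertCopy V :=
    { toFun := fun x ↦ x, invFun := fun x ↦ x, map_add' := fun _ _ ↦ rfl,
      map_smul' := fun _ _ ↦ rfl, left_inv := fun _ ↦ rfl, right_inv := fun _ ↦ rfl }
  -- The new squared norm `b x x` lies between `c * ‖x‖ ^ 2` and `‖b‖ * ‖x‖ ^ 2`, whence the two
  -- constants.
  let e : V ≃L[ℝ] HilbertCopy V := l.toContinuousLinearEquivOfBounds (√‖b‖) (√c)⁻¹
    (fun x ↦ by
      refine abs_le_of_sq_le_sq' ?_ (by positivity) |>.2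
      rw [mul_pow, Real.sq_sqrt (norm_nonneg b)]
      refine (hnorm x).trans_le ((le_abs_self _).trans ((b.le_opNorm₂ x x).trans_eq ?_))
      ring)
    (fun x ↦ by
      refine abs_le_of_sq_le_sq' ?_ (by positivity) |>.2
      rw [mul_pow, inv_pow, Real.sq_sqrt hc.le, inv_mul_eq_div, le_div_iff₀ hc, mul_comm]
      exact (hbc x).trans_eq (hnorm x).symm)
  exact ⟨HilbertCopy V, inferInstance, inferInstance,
    (completeSpace_congr (e := e.symm.toEquiv) e.symm.isUniformEmbedding).2 inferInstance, ⟨e⟩⟩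

/-- Coercivity makes `V` isomorphic to a Hilbert space `W`, and `V*` isomorphic to `W` through the
inner product of `W`. -/
theorem IsCoerciveOperator.exists_riesz {V : Type u} {H : Type*} [NormedAddCommGroup V]
    [NormedSpace ℝ V] [CompleteSpace V] [NormedAddCommGroup H] [InnerProductSpace ℝ H]
    {ι : V →L[ℝ] H} {A : V →L[ℝ] StrongDual ℝ V} (hA : IsCoerciveOperator ι A) :
    ∃ (W : Type u) (_ : NormedAddCommGroup W) (_ : InnerProductSpace ℝ W) (_ : CompleteSpace W)
      (e : V ≃L[ℝ] W) (R : W ≃L[ℝ] StrongDual ℝ V), ∀ w v, R w v = inner ℝ w (e v) := by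
  obtain ⟨lam, α, hlam, hα, hco⟩ := hA
  -- The form is $\lambda(\iota x,\iota y)_H$ minus the symmetrization of `A`; its lower bound `α`
  -- is exactly the coercivity hypothesis.
  obtain ⟨W, hW1, hW2, hW3, ⟨e⟩⟩ := exists_hilbert_equiv_of_coercive
    (lam • (pivotToDual ι).comp ι - (A + A.flip)) (fun x y ↦ by
      change lam * inner ℝ (ι x) (ι y) - (A x y + A y x) =
        lam * inner ℝ (ι y) (ι x) - (A y x + A x y)
      rw [real_inner_comm, add_comm]) hα (fun x ↦ by
      change _ ≤ lam * inner ℝ (ι x) (ι x) - (A x x + A x x)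
      rw [real_inner_self_eq_norm_sq]
      linarith [hco x])
  let R₀ : W →L[ℝ] StrongDual ℝ V :=
    (ContinuousLinearMap.precomp ℝ (e : V →L[ℝ] W)).comp (innerSL ℝ)
  have hR₀ : ∀ w v, R₀ w v = inner ℝ w (e v) := fun _ _ ↦ rfl
  have hker : R₀.ker = ⊥ := by
    refine LinearMap.ker_eq_bot'.2 fun w hw ↦ ?_
    have h1 : R₀ w (e.symm w) = 0 := by
      change (R₀ : W →ₗ[ℝ] StrongDual ℝ V) w (e.symm w) = 0
      rw [hw, zero_apply]
    rw [hR₀, e.apply_symm_apply] at h1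
    exact inner_self_eq_zero.1 h1
  have hrange : R₀.range = ⊤ := by
    refine LinearMap.range_eq_top.2 fun f ↦
      ⟨(InnerProductSpace.toDual ℝ W).symm (f.comp (e.symm : W →L[ℝ] V)), ?_⟩
    ext v
    refine (InnerProductSpace.toDual_symm_apply).trans ?_
    simp
  exact ⟨W, hW1, hW2, hW3, e, ContinuousLinearEquiv.ofBijective R₀ hker hrange, fun w v ↦ rfl⟩

end Hilbert

/-! ### The a priori estimate. -/

section Energy

variable {V H : Type*} [NormedAddCommGroup V] [NormedSpace ℝ V]
  [NormedAddCommGroup H] [InnerProductSpace ℝ H]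

/-- The energy estimate for continuously differentiable solutions. -/
theorem energy_estimate {ι : V →L[ℝ] H} {A : V →L[ℝ] StrongDual ℝ V} {lam α : ℝ} (hlam : 0 < lam)
    (hα : 0 < α) (hco : ∀ u : V, 2 * A u u + α * ‖u‖ ^ 2 ≤ lam * ‖ι u‖ ^ 2) {T : ℝ}
    {u u' : ℝ → V} {f : ℝ → StrongDual ℝ V} (hu : ∀ t, HasDerivAt u (u' t) t) (hf : Continuous f)
    (heq : ∀ t, pivotToDual ι (ι (u' t)) = A (u t) + f t) {t : ℝ} (ht : t ∈ Icc 0 T) :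
    ‖ι (u t)‖ ^ 2 + α / 2 * ∫ s in (0)..t, ‖u s‖ ^ 2 ≤
      Real.exp (lam * T) * (‖ι (u 0)‖ ^ 2 + 2 / α * ∫ s in (0)..T, ‖f s‖ ^ 2) := by
  have huc : Continuous u := continuous_iff_continuousAt.2 fun t ↦ (hu t).continuousAt
  set p : ℝ → ℝ := fun t ↦ ∫ s in (0)..t, ‖u s‖ ^ 2 with hp
  set q : ℝ → ℝ := fun t ↦ ∫ s in (0)..t, ‖f s‖ ^ 2 with hq
  -- The factor $e^{-\lambda t}$ absorbs the term $\lambda|u|_H^2$, and `q` compensates the source,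
  -- so that `Ψ` decreases.
  set Ψ : ℝ → ℝ := fun t ↦ Real.exp (-(lam * t)) * (‖ι (u t)‖ ^ 2 + α / 2 * p t) - 2 / α * q t
    with hΨ
  have hpd : ∀ t, HasDerivAt p (‖u t‖ ^ 2) t := fun t ↦
    ((show Continuous fun s ↦ ‖u s‖ ^ 2 by fun_prop).integral_hasStrictDerivAt 0 t).hasDerivAt
  have hqd : ∀ t, HasDerivAt q (‖f t‖ ^ 2) t := fun t ↦
    ((show Continuous fun s ↦ ‖f s‖ ^ 2 by fun_prop).integral_hasStrictDerivAt 0 t).hasDerivAt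
  have hyd : ∀ t, HasDerivAt (fun t ↦ ‖ι (u t)‖ ^ 2) (2 * (A (u t) (u t) + f t (u t))) t := by
    intro t
    have h1 := (ι.hasFDerivAt.comp_hasDerivAt t (hu t)).norm_sq
    have h2 : inner ℝ (ι (u t)) (ι (u' t)) = A (u t) (u t) + f t (u t) := by
      rw [real_inner_comm, ← pivotToDual_apply, heq t, add_apply]
    rw [← h2]
    exact h1
  have hed : ∀ t, HasDerivAt (fun t ↦ Real.exp (-(lam * t)))
      (Real.exp (-(lam * t)) * (-(lam * 1))) t := fun t ↦
    (((hasDerivAt_id t).const_mul lam).neg).exp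
  have hΨd : ∀ t, HasDerivAt Ψ (Real.exp (-(lam * t)) * (-(lam * 1)) * (‖ι (u t)‖ ^ 2 + α / 2 * p t)
      + Real.exp (-(lam * t)) * (2 * (A (u t) (u t) + f t (u t)) + α / 2 * ‖u t‖ ^ 2) -
      2 / α * ‖f t‖ ^ 2) t := fun t ↦
    ((hed t).mul ((hyd t).add ((hpd t).const_mul _))).sub ((hqd t).const_mul _)
  have hp0 : ∀ t, 0 ≤ t → 0 ≤ p t := fun t ht ↦
    intervalIntegral.integral_nonneg ht fun s _ ↦ sq_nonneg _
  have hanti : AntitoneOn Ψ (Icc 0 T) := by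
    refine antitoneOn_of_deriv_nonpos (convex_Icc 0 T)
      (fun t _ ↦ (hΨd t).continuousAt.continuousWithinAt)
      (fun t _ ↦ (hΨd t).differentiableAt.differentiableWithinAt) fun t ht ↦ ?_
    rw [interior_Icc] at ht
    rw [(hΨd t).deriv]
    have h1 : f t (u t) ≤ ‖f t‖ * ‖u t‖ := (le_abs_self _).trans ((f t).le_opNorm (u t))
    -- Young's inequality spends half of the coercive term `α * ‖u t‖ ^ 2`; the other half survives
    -- as `α / 2 * p t`.
    have h2 : 2 * (‖f t‖ * ‖u t‖) ≤ α / 2 * ‖u t‖ ^ 2 + 2 / α * ‖f t‖ ^ 2 := by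
      have h3 : α / 2 * ‖u t‖ ^ 2 + 2 / α * ‖f t‖ ^ 2 - 2 * (‖f t‖ * ‖u t‖) =
          (α * ‖u t‖ - 2 * ‖f t‖) ^ 2 / (2 * α) := by field_simp; ring
      have h4 : 0 ≤ (α * ‖u t‖ - 2 * ‖f t‖) ^ 2 / (2 * α) := by positivity
      linarith
    have h5 : 2 * (A (u t) (u t) + f t (u t)) + α / 2 * ‖u t‖ ^ 2 ≤
        lam * ‖ι (u t)‖ ^ 2 + 2 / α * ‖f t‖ ^ 2 := by linarith [hco (u t)]
    have h6 : Real.exp (-(lam * t)) ≤ 1 :=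
      Real.exp_le_one_iff.2 (neg_nonpos.2 (mul_nonneg hlam.le ht.1.le))
    have h7 := mul_le_mul_of_nonneg_left h5 (Real.exp_pos (-(lam * t))).le
    have h8 : Real.exp (-(lam * t)) * (2 / α * ‖f t‖ ^ 2) ≤ 2 / α * ‖f t‖ ^ 2 :=
      mul_le_of_le_one_left (by positivity) h6
    have h9 : 0 ≤ Real.exp (-(lam * t)) * (lam * (α / 2 * p t)) := by
      have := hp0 t ht.1.le
      positivity
    linarith
  have h1 := hanti (left_mem_Icc.2 (ht.1.trans ht.2)) ht ht.1
  have hq1 : q t ≤ q T := by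
    have hqm : Continuous fun s ↦ ‖f s‖ ^ 2 := by fun_prop
    exact intervalIntegral.integral_mono_interval le_rfl ht.1 ht.2
      (Filter.Eventually.of_forall fun s ↦ sq_nonneg _) (hqm.intervalIntegrable _ _)
  have h2 : Ψ 0 = ‖ι (u 0)‖ ^ 2 := by simp [hΨ, hp, hq]
  rw [h2] at h1
  have h3 : Real.exp (-(lam * t)) * (‖ι (u t)‖ ^ 2 + α / 2 * p t) ≤
      ‖ι (u 0)‖ ^ 2 + 2 / α * q T := by
    have := mul_le_mul_of_nonneg_left hq1 (show 0 ≤ 2 / α by positivity)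
    simp only [hΨ] at h1
    linarith
  have hqT : 0 ≤ q T := intervalIntegral.integral_nonneg (ht.1.trans ht.2) fun s _ ↦ sq_nonneg _
  calc ‖ι (u t)‖ ^ 2 + α / 2 * p t
      = Real.exp (lam * t) * (Real.exp (-(lam * t)) * (‖ι (u t)‖ ^ 2 + α / 2 * p t)) := by
        rw [← mul_assoc, ← Real.exp_add]; simp
    _ ≤ Real.exp (lam * T) * (‖ι (u 0)‖ ^ 2 + 2 / α * q T) := by
        have h4 : Real.exp (lam * t) ≤ Real.exp (lam * T) :=
          Real.exp_le_exp.2 (mul_le_mul_of_nonneg_left ht.2 hlam.le)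
        exact mul_le_mul h4 h3 (mul_nonneg (Real.exp_pos _).le (by
          have := hp0 t ht.1
          positivity)) (Real.exp_pos _).le

end Energy

/-! ### The backward adjoint equation. -/

section Density

variable {V H : Type*} [NormedAddCommGroup V] [NormedSpace ℝ V]
  [NormedAddCommGroup H] [InnerProductSpace ℝ H]

/-- Only the diagonal values `A u u` occur, and transposition does not change them. -/
theorem IsCoerciveOperator.flip {ι : V →L[ℝ] H} {A : V →L[ℝ] StrongDual ℝ V}
    (hA : IsCoerciveOperator ι A) : IsCoerciveOperator ι A.flip :=
  hA

theorem measurePreserving_timeReversal (T : ℝ) :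
    MeasurePreserving (fun t ↦ T - t) (timeMeasure T) (timeMeasure T) := by
  have h := (Measure.measurePreserving_sub_left volume T).restrict_preimage
    (measurableSet_Icc (a := (0 : ℝ)) (b := T))
  have h1 : (fun t ↦ T - t) ⁻¹' Icc 0 T = Icc 0 T := by simp
  rwa [h1] at h

/-- An integrable function `g` with `g(t) = A ∫ₜᵀ g` in the dual vanishes almost everywhere. -/
theorem ae_eq_zero_of_pivot_eq_backward_primitive [CompleteSpace V] [CompleteSpace H]
    {ι : V →L[ℝ] H} (hι : IsGelfandEmbedding ι) {A : V →L[ℝ] StrongDual ℝ V}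
    (hA : IsCoerciveOperator ι A) {T : ℝ} {g : ℝ → V} (hg : Integrable g (timeMeasure T))
    (h : ∀ᵐ t ∂timeMeasure T, pivotToDual ι (ι (g t)) = A (∫ s in t..T, g s)) :
    ∀ᵐ t ∂timeMeasure T, g t = 0 := by
  have hmp := measurePreserving_timeReversal T
  have h1 := ae_eq_zero_of_pivot_eq_primitive hι hA (u := fun t ↦ g (T - t))
    (hmp.integrable_comp_of_integrable hg) (by
      filter_upwards [hmp.quasiMeasurePreserving.ae h] with t ht
      rw [ht, intervalIntegral.integral_comp_sub_left, sub_zero])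
  filter_upwards [hmp.quasiMeasurePreserving.ae h1] with t ht
  rwa [sub_sub_cancel] at ht

/-- The test curves vanish at `0` but are free at `T`, so `g` solves the adjoint equation with its
zero terminal condition built in: no unknown constant appears, and backward uniqueness applies. -/
theorem ae_eq_zero_of_annihilates [CompleteSpace V] [CompleteSpace H]
    {ι : V →L[ℝ] H} (hι : IsGelfandEmbedding ι) {A : V →L[ℝ] StrongDual ℝ V}
    (hA : IsCoerciveOperator ι A) {T : ℝ} (hT : 0 < T) {g : ℝ → V}
    (hg : Integrable g (timeMeasure T))
    (h : ∀ (u u' : ℝ → V), Continuous u' → (∀ t, HasDerivAt u (u' t) t) → u 0 = 0 →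
      ∫ t, (pivotToDual ι (ι (u' t)) - A (u t)) (g t) ∂timeMeasure T = 0) :
    ∀ᵐ t ∂timeMeasure T, g t = 0 := by
  have hp : Integrable (fun t ↦ pivotToDual ι (ι (g t))) (timeMeasure T) :=
    ((pivotToDual ι).comp ι).integrable_comp hg
  have hq : Integrable (fun t ↦ A.flip (g t)) (timeMeasure T) := A.flip.integrable_comp hg
  have hgI : ∀ a ∈ Icc 0 T, ∀ b ∈ Icc 0 T, IntervalIntegrable g volume a b :=
    fun a ha b hb ↦ IntegrableOn.intervalIntegrable (hg.mono_measure
      (Measure.restrict_mono (uIcc_subset_Icc ha hb) le_rfl))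
  set Q : ℝ → StrongDual ℝ V := fun t ↦ ∫ s in (0)..t, A.flip (g s) with hQ
  have hQc : ContinuousOn Q (Icc 0 T) := by
    have := intervalIntegral.continuousOn_primitive_interval (μ := volume) (a := 0) (b := T)
      (f := fun s ↦ A.flip (g s)) (by rw [uIcc_of_le hT.le]; exact hq)
    rwa [uIcc_of_le hT.le] at this
  have hQi : Integrable Q (timeMeasure T) := hQc.integrableOn_Icc
  have hsmul : ∀ ψ : ℝ → ℝ, Continuous ψ → ∀ f : ℝ → StrongDual ℝ V,
      Integrable f (timeMeasure T) → Integrable (fun t ↦ ψ t • f t) (timeMeasure T) :=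
    fun ψ hψ f hf ↦ IntegrableOn.continuousOn_smul hf hψ.continuousOn isCompact_Icc
  have key : ∀ χ : ℝ → ℝ, ContDiff ℝ ∞ χ → HasCompactSupport χ → tsupport χ ⊆ Ioo 0 T →
      ∫ t, χ t • (pivotToDual ι (ι (g t)) - (Q T - Q t)) = 0 := by
    intro χ hχ _ hχs
    have hχc := hχ.continuous
    set ψ : ℝ → ℝ := fun t ↦ ∫ s in (0)..t, χ s with hψ
    have hψd : ∀ t, HasDerivAt ψ (χ t) t := fun t ↦
      (hχc.integral_hasStrictDerivAt 0 t).hasDerivAt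
    have hψc : Continuous ψ := continuous_iff_continuousAt.2 fun t ↦ (hψd t).continuousAt
    -- The test curves are `ψ t • v` with `v` arbitrary; `v` is then stripped off to leave an
    -- identity in the dual.
    have h1 : ∫ t, (χ t • pivotToDual ι (ι (g t)) - ψ t • A.flip (g t)) ∂timeMeasure T = 0 := by
      ext v
      rw [ContinuousLinearMap.integral_apply
        (show Integrable (fun t ↦ χ t • pivotToDual ι (ι (g t)) - ψ t • A.flip (g t))
          (timeMeasure T) from (hsmul χ hχc _ hp).sub (hsmul ψ hψc _ hq)),
        zero_apply, ← h (fun t ↦ ψ t • v) (fun t ↦ χ t • v) (by fun_prop)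
        (fun t ↦ (hψd t).smul_const v) (by simp [hψ])]
      refine integral_congr_ae (Filter.Eventually.of_forall fun t ↦ ?_)
      simp only [sub_apply, smul_apply, map_smul, pivotToDual_apply,
        ContinuousLinearMap.flip_apply, real_inner_comm]
    -- Integration by parts moves the primitive from `χ` to `A.flip (g t)`; the boundary term at `T`
    -- produces `Q T`.
    have h2 := bilin_integral_eq_add (ContinuousLinearMap.lsmul ℝ ℝ) hT.le
      (f := χ) (g := fun t ↦ A.flip (g t)) (hχc.continuousOn.integrableOn_Icc.mono_set
        Ioc_subset_Icc_self) (IntegrableOn.mono_set hq Ioc_subset_Icc_self)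
    simp only [ContinuousLinearMap.lsmul_apply] at h2
    rw [intervalIntegral.integral_of_le hT.le (μ := volume) (f := fun t ↦ χ t • _),
      intervalIntegral.integral_of_le hT.le (μ := volume) (f := fun t ↦ (∫ s in (0)..t, χ s) • _),
      intervalIntegral.integral_of_le hT.le (μ := volume) (f := χ),
      ← integral_Icc_eq_integral_Ioc, ← integral_Icc_eq_integral_Ioc,
      ← integral_Icc_eq_integral_Ioc] at h2
    have h3 : ∫ t, χ t • (pivotToDual ι (ι (g t)) - (Q T - Q t)) =
        ∫ t, χ t • (pivotToDual ι (ι (g t)) - (Q T - Q t)) ∂timeMeasure T :=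
      (setIntegral_eq_integral_of_forall_compl_eq_zero fun t ht ↦ by
        rw [image_eq_zero_of_notMem_tsupport fun h ↦ ht (Ioo_subset_Icc_self (hχs h)),
          zero_smul]).symm
    rw [integral_sub (hsmul χ hχc _ hp) (hsmul ψ hψc _ hq), sub_eq_zero] at h1
    rw [h3]
    simp only [smul_sub]
    rw [integral_sub (hsmul χ hχc _ hp)
      (show Integrable (fun t ↦ χ t • Q T - χ t • Q t) (timeMeasure T) from
        (hsmul χ hχc _ (integrable_const (Q T))).sub (hsmul χ hχc _ hQi)),
      integral_sub (hsmul χ hχc _ (integrable_const (Q T))) (hsmul χ hχc _ hQi), h1,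
      integral_smul_const]
    change (∫ t, χ t ∂timeMeasure T) • Q T = (∫ t, χ t • Q t ∂timeMeasure T) +
      ∫ t, ψ t • A.flip (g t) ∂timeMeasure T at h2
    rw [h2]
    abel
  have hae := isOpen_Ioo.ae_eq_zero_of_integral_contDiff_smul_eq_zero (μ := volume)
    (f := fun t ↦ pivotToDual ι (ι (g t)) - (Q T - Q t)) (U := Ioo 0 T)
    (IntegrableOn.locallyIntegrableOn (IntegrableOn.mono_set
      (hp.sub ((integrable_const (Q T)).sub hQi)) Ioo_subset_Icc_self)) key
  have hμ : timeMeasure T = volume.restrict (Ioo 0 T) :=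
    Measure.restrict_congr_set Ioo_ae_eq_Icc.symm
  refine ae_eq_zero_of_pivot_eq_backward_primitive hι hA.flip hg ?_
  rw [hμ, ae_restrict_iff' measurableSet_Ioo]
  filter_upwards [hae] with t ht htm
  have h0 : (0 : ℝ) ∈ Icc 0 T := left_mem_Icc.2 hT.le
  have h1 : T ∈ Icc 0 T := right_mem_Icc.2 hT.le
  have h2 : t ∈ Icc 0 T := Ioo_subset_Icc_self htm
  rw [sub_eq_zero.1 (ht htm), hQ]
  simp only
  rw [A.flip.intervalIntegral_comp_comm (hgI 0 h0 T h1),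
    A.flip.intervalIntegral_comp_comm (hgI 0 h0 t h2), ← map_sub,
    intervalIntegral.integral_interval_sub_left (hgI 0 h0 T h1) (hgI 0 h0 t h2)]

end Density

/-! ### Classical solutions: density of their data and boundedness of the solution map. -/

section Existence

theorem memLp_timeMeasure_of_continuous {E : Type*} [NormedAddCommGroup E] {f : ℝ → E}
    (hf : Continuous f) (p : ℝ≥0∞) (T : ℝ) : MemLp f p (timeMeasure T) := by
  obtain ⟨C, hC⟩ := isCompact_Icc.exists_bound_of_continuousOn (hf.continuousOn (s := Icc 0 T))
  exact MemLp.of_bound hf.aestronglyMeasurable C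
    (ae_restrict_of_forall_mem measurableSet_Icc hC)

theorem norm_sq_L2Time {E : Type*} [NormedAddCommGroup E] {T : ℝ} (u : L2Time T E) :
    ‖u‖ ^ 2 = ∫ t, ‖u t‖ ^ 2 ∂timeMeasure T := by
  rw [Lp.norm_def, toReal_eLpNorm (Lp.aestronglyMeasurable u),
    lpNorm_eq_integral_norm_rpow_toReal two_ne_zero ENNReal.ofNat_ne_top
      (Lp.aestronglyMeasurable u), ENNReal.toReal_ofNat, ← Real.rpow_natCast, ← Real.rpow_mul
      (integral_nonneg fun t ↦ by positivity)]
  norm_num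

/-- Continuity of `u ↦ ∫ ψ u` on `L²([0,T];E)`, followed by a bounded linear map. -/
theorem continuous_integral_smul_L2Time {E F : Type*} [NormedAddCommGroup E] [NormedSpace ℝ E]
    [NormedAddCommGroup F] [NormedSpace ℝ F] [CompleteSpace F] (L : E →L[ℝ] F) (T : ℝ) {ψ : ℝ → ℝ}
    (hψ : Continuous ψ) :
    Continuous fun u : L2Time T E ↦ ∫ t, ψ t • L (u t) ∂timeMeasure T := by
  have hψ2 := memLp_timeMeasure_of_continuous hψ 2 T
  have h1 : ∀ u : L2Time T E, ((ContinuousLinearMap.lsmul ℝ ℝ).lpPairing (timeMeasure T) 2 2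
      (hψ2.toLp ψ) (L.compLp u) : F) = ∫ t, ψ t • L (u t) ∂timeMeasure T := fun u ↦ by
    rw [ContinuousLinearMap.lpPairing_eq_integral]
    refine integral_congr_ae ?_
    filter_upwards [hψ2.coeFn_toLp, L.coeFn_compLp u] with t h2 h3
    rw [h2, h3]
    rfl
  simp only [← h1]
  exact (ContinuousLinearMap.continuous _).comp (L.compLpL 2 (timeMeasure T)).continuous

variable {V H W : Type*} [NormedAddCommGroup V] [NormedSpace ℝ V]
  [NormedAddCommGroup H] [InnerProductSpace ℝ H] [NormedAddCommGroup W] [InnerProductSpace ℝ W]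

/-- The tuples `(u₀, b, u, w)` in which `u` is the class of a continuously differentiable function
with values in `V` that solves `u' = A u + R b` with `u(0) = u₀`, and `w = u` on `[0,T]`. -/
def classicalGraph (ι : V →L[ℝ] H) (A : V →L[ℝ] StrongDual ℝ V) (R : W ≃L[ℝ] StrongDual ℝ V)
    (T : ℝ) :
    Submodule ℝ (WithLp 2 (H × L2Time T W) × L2Time T V × BoundedContinuousFunction ℝ H) where
  -- The data carry the ℓ² product norm, which makes them an inner product space. Clamping time to
  -- `[0,T]` makes the last component bounded on the line, with sup norm taken over `[0,T]`.
  carrier := {x | ∃ u u' : ℝ → V, Continuous u' ∧ (∀ t, HasDerivAt u (u' t) t) ∧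
    x.1.fst = ι (u 0) ∧
    (∀ᵐ t ∂timeMeasure T, R (x.1.snd t) = pivotToDual ι (ι (u' t)) - A (u t)) ∧
    (∀ᵐ t ∂timeMeasure T, x.2.1 t = u t) ∧ ∀ t, x.2.2 t = ι (u (max 0 (min t T)))}
  add_mem' := by
    rintro x y ⟨u, u', hc, hd, h1, h2, h3, h4⟩ ⟨v, v', hc', hd', h1', h2', h3', h4'⟩
    refine ⟨u + v, u' + v', hc.add hc', fun t ↦ (hd t).add (hd' t), ?_, ?_, ?_, fun t ↦ ?_⟩
    · simp [h1, h1']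
    · filter_upwards [h2, h2', Lp.coeFn_add x.1.snd y.1.snd] with t e1 e2 e3
      rw [Prod.fst_add, WithLp.add_snd, e3]
      simp only [Pi.add_apply, map_add, e1, e2]
      abel
    · filter_upwards [h3, h3', Lp.coeFn_add x.2.1 y.2.1] with t e1 e2 e3
      rw [Prod.snd_add, Prod.fst_add, e3, Pi.add_apply, Pi.add_apply, e1, e2]
    · simp [h4, h4']
  zero_mem' := by
    refine ⟨0, 0, continuous_zero, fun t ↦ hasDerivAt_const t 0, by simp, ?_, ?_, by simp⟩
    · filter_upwards [Lp.coeFn_zero W 2 (timeMeasure T)] with t e1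
      rw [Prod.fst_zero, WithLp.zero_snd, e1]
      simp
    · filter_upwards [Lp.coeFn_zero V 2 (timeMeasure T)] with t e1
      rw [Prod.snd_zero, Prod.fst_zero, e1]
  smul_mem' := by
    rintro c x ⟨u, u', hc, hd, h1, h2, h3, h4⟩
    refine ⟨c • u, c • u', hc.const_smul c, fun t ↦ (hd t).const_smul c, ?_, ?_, ?_, fun t ↦ ?_⟩
    · simp [h1]
    · filter_upwards [h2, Lp.coeFn_smul c x.1.snd] with t e1 e3
      rw [Prod.smul_fst, WithLp.smul_snd, e3]
      simp only [Pi.smul_apply, map_smul, e1, smul_sub]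
    · filter_upwards [h3, Lp.coeFn_smul c x.2.1] with t e1 e3
      rw [Prod.smul_snd, Prod.smul_fst, e3, Pi.smul_apply, Pi.smul_apply, e1]
    · simp [h4]

theorem exists_mem_classicalGraph (ι : V →L[ℝ] H) (A : V →L[ℝ] StrongDual ℝ V)
    (R : W ≃L[ℝ] StrongDual ℝ V) {T : ℝ} (hT : 0 < T) {u u' : ℝ → V} (hc : Continuous u')
    (hd : ∀ t, HasDerivAt u (u' t) t) :
    ∃ x ∈ classicalGraph ι A R T, x.1.fst = ι (u 0) ∧
      ∀ᵐ t ∂timeMeasure T, R (x.1.snd t) = pivotToDual ι (ι (u' t)) - A (u t) := by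
  have huc : Continuous u := continuous_iff_continuousAt.2 fun t ↦ (hd t).continuousAt
  have hfc : Continuous fun t ↦ R.symm (pivotToDual ι (ι (u' t)) - A (u t)) := by fun_prop
  have hf2 := memLp_timeMeasure_of_continuous hfc 2 T
  have hu2 := memLp_timeMeasure_of_continuous huc 2 T
  have hwc : Continuous fun t ↦ ι (u (max 0 (min t T))) := by fun_prop
  obtain ⟨C, hC⟩ := isCompact_Icc.exists_bound_of_continuousOn
    ((ι.continuous.comp huc).continuousOn (s := Icc 0 T))
  let w : BoundedContinuousFunction ℝ H := BoundedContinuousFunction.ofNormedAddCommGroup _ hwc C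
    fun t ↦ hC _ ⟨le_max_left _ _, max_le hT.le (min_le_right _ _)⟩
  have hR : ∀ᵐ t ∂timeMeasure T, R (hf2.toLp _ t) = pivotToDual ι (ι (u' t)) - A (u t) := by
    filter_upwards [hf2.coeFn_toLp] with t ht
    rw [ht, R.apply_symm_apply]
  exact ⟨(WithLp.toLp 2 (ι (u 0), hf2.toLp _), hu2.toLp u, w),
    ⟨u, u', hc, hd, rfl, hR, hu2.coeFn_toLp, fun t ↦ rfl⟩, rfl, hR⟩

/-- By `hR`, the inner product with `d.snd` is the duality pairing with the `V`-valued function `g`.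
Curves starting at zero force `g` to vanish; constant curves then force `d.fst` to vanish, by
density of the range of `ι`. -/
theorem dense_map_fst_classicalGraph [CompleteSpace V] [CompleteSpace H] [CompleteSpace W]
    {ι : V →L[ℝ] H} (hι : IsGelfandEmbedding ι) {A : V →L[ℝ] StrongDual ℝ V}
    (hA : IsCoerciveOperator ι A) {e : V ≃L[ℝ] W} {R : W ≃L[ℝ] StrongDual ℝ V}
    (hR : ∀ w v, R w v = inner ℝ w (e v)) {T : ℝ} (hT : 0 < T) :
    ((classicalGraph ι A R T).map (LinearMap.fst ℝ _ _)).topologicalClosure = ⊤ := by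
  rw [Submodule.topologicalClosure_eq_top_iff, Submodule.eq_bot_iff]
  intro d hd
  set g : ℝ → V := fun t ↦ e.symm (d.snd t) with hg
  have hgi : Integrable g (timeMeasure T) :=
    (e.symm : W →L[ℝ] V).integrable_comp (integrable_of_L2Time d.snd)
  have key : ∀ u u' : ℝ → V, Continuous u' → (∀ t, HasDerivAt u (u' t) t) →
      inner ℝ (ι (u 0)) d.fst +
        ∫ t, (pivotToDual ι (ι (u' t)) - A (u t)) (g t) ∂timeMeasure T = 0 := by
    intro u u' hc hd'
    obtain ⟨x, hx, hx0, hxR⟩ := exists_mem_classicalGraph ι A R hT hc hd'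
    have h1 := Submodule.inner_right_of_mem_orthogonal (Submodule.mem_map_of_mem hx) hd
    rw [WithLp.prod_inner_apply, L2.inner_def] at h1
    refine Eq.trans ?_ h1
    congr 1
    · exact congrArg (inner ℝ · d.fst) hx0.symm
    · refine integral_congr_ae ?_
      filter_upwards [hxR] with t ht
      rw [← ht, hR, hg]
      simp only [e.apply_symm_apply]
      rfl
  have hg0 := ae_eq_zero_of_annihilates hι hA hT hgi fun u u' hc hd' h0 ↦ by
    have := key u u' hc hd'
    rwa [h0, map_zero, inner_zero_left, zero_add] at this
  have h2 : d.snd = 0 := Lp.eq_zero_iff_ae_eq_zero.2 (by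
    filter_upwards [hg0] with t ht
    exact e.symm.map_eq_zero_iff.1 ht)
  have h3 : d.fst = 0 := by
    refine hι.denseRange.eq_zero_of_inner_right ℝ fun v ↦ ?_
    have := key (fun _ ↦ v) (fun _ ↦ 0) continuous_const fun t ↦ hasDerivAt_const t v
    rw [integral_congr_ae (g := fun _ ↦ (0 : ℝ)) (by
      filter_upwards [hg0] with t ht
      rw [ht, map_zero])] at this
    simpa using this
  exact (WithLp.ofLp_injective 2) (Prod.ext h3 h2)

theorem exists_norm_snd_le_of_mem_classicalGraph {ι : V →L[ℝ] H} {A : V →L[ℝ] StrongDual ℝ V}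
    (hA : IsCoerciveOperator ι A) (R : W ≃L[ℝ] StrongDual ℝ V) {T : ℝ} (hT : 0 < T) :
    ∃ C : ℝ, 0 ≤ C ∧ ∀ x ∈ classicalGraph ι A R T, ‖x.2‖ ≤ C * ‖x.1‖ := by
  obtain ⟨lam, α, hlam, hα, hco⟩ := hA
  set r : ℝ := ‖(R : W →L[ℝ] StrongDual ℝ V)‖ with hr
  set K : ℝ := Real.exp (lam * T) * (1 + 2 / α * r ^ 2) with hK
  have hKpos : 0 ≤ K := by positivity
  have hK' : 0 ≤ (1 + 2 / α) * K := by positivity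
  -- The factor `1 + 2 / α` dominates both `1`, needed for the sup norm, and `2 / α`, needed for the
  -- $L^2$ norm.
  refine ⟨√((1 + 2 / α) * K), Real.sqrt_nonneg _, ?_⟩
  rintro x ⟨u, u', hc, hd, h1, h2, h3, h4⟩
  have huc : Continuous u := continuous_iff_continuousAt.2 fun t ↦ (hd t).continuousAt
  set f : ℝ → StrongDual ℝ V := fun t ↦ pivotToDual ι (ι (u' t)) - A (u t) with hf
  have hfc : Continuous f := by fun_prop
  have hIcc : ∀ φ : ℝ → ℝ, ∫ t in (0)..T, φ t = ∫ t, φ t ∂timeMeasure T := fun φ ↦ by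
    rw [intervalIntegral.integral_of_le hT.le, integral_Icc_eq_integral_Ioc]
  have hfL : ∫ t in (0)..T, ‖f t‖ ^ 2 ≤ r ^ 2 * ‖x.1.snd‖ ^ 2 := by
    rw [hIcc, norm_sq_L2Time, ← integral_const_mul]
    refine integral_mono_ae
      ((show Continuous fun t ↦ ‖f t‖ ^ 2 by fun_prop).continuousOn.integrableOn_Icc)
      (((Lp.memLp x.1.snd).integrable_norm_pow two_ne_zero).const_mul _) ?_
    filter_upwards [h2] with t ht
    rw [← mul_pow]
    refine pow_le_pow_left₀ (norm_nonneg _) ?_ 2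
    rw [hf]
    simp only
    rw [← ht]
    exact (R : W →L[ℝ] StrongDual ℝ V).le_opNorm _
  have hdn : ‖x.1‖ ^ 2 = ‖x.1.fst‖ ^ 2 + ‖x.1.snd‖ ^ 2 := WithLp.prod_norm_sq_eq_of_L2 x.1
  have hest : ∀ t ∈ Icc 0 T, ‖ι (u t)‖ ^ 2 + α / 2 * ∫ s in (0)..t, ‖u s‖ ^ 2 ≤ K * ‖x.1‖ ^ 2 := by
    intro t ht
    refine (energy_estimate hlam hα hco hd hfc (fun t ↦ (add_sub_cancel _ _).symm) ht).trans ?_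
    rw [hK, mul_assoc]
    refine mul_le_mul_of_nonneg_left ?_ (Real.exp_pos _).le
    rw [← h1, hdn]
    have h5 := mul_le_mul_of_nonneg_left hfL (show 0 ≤ 2 / α by positivity)
    have h6 : 0 ≤ 2 / α * r ^ 2 * ‖x.1.fst‖ ^ 2 := by positivity
    nlinarith [sq_nonneg ‖x.1.snd‖]
  have hα1 : (1 : ℝ) ≤ 1 + 2 / α := le_add_of_nonneg_right (by positivity)
  have hα2 : 2 / α ≤ 1 + 2 / α := le_add_of_nonneg_left zero_le_one
  have hKd : 0 ≤ K * ‖x.1‖ ^ 2 := by positivity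
  have hL2 : ‖x.2.1‖ ≤ √((1 + 2 / α) * K) * ‖x.1‖ := by
    refine abs_le_of_sq_le_sq' ?_ (by positivity) |>.2
    rw [mul_pow, Real.sq_sqrt hK', norm_sq_L2Time, mul_assoc]
    have h5 : ∫ t, ‖x.2.1 t‖ ^ 2 ∂timeMeasure T = ∫ t in (0)..T, ‖u t‖ ^ 2 := by
      rw [hIcc]
      refine integral_congr_ae ?_
      filter_upwards [h3] with t ht
      rw [ht]
    have h6 := hest T (right_mem_Icc.2 hT.le)
    have h7 : ∫ t in (0)..T, ‖u t‖ ^ 2 ≤ 2 / α * (K * ‖x.1‖ ^ 2) := by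
      rw [div_mul_eq_mul_div, le_div_iff₀ hα]
      nlinarith [sq_nonneg ‖ι (u T)‖]
    rw [h5]
    exact h7.trans (mul_le_mul_of_nonneg_right hα2 hKd)
  have hsup : ‖x.2.2‖ ≤ √((1 + 2 / α) * K) * ‖x.1‖ := by
    refine (BoundedContinuousFunction.norm_le (by positivity)).2 fun t ↦ ?_
    rw [h4]
    refine abs_le_of_sq_le_sq' ?_ (by positivity) |>.2
    rw [mul_pow, Real.sq_sqrt hK', mul_assoc]
    have hmem : max 0 (min t T) ∈ Icc 0 T :=
      ⟨le_max_left _ _, max_le hT.le (min_le_right _ _)⟩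
    have h5 : 0 ≤ α / 2 * ∫ s in (0)..max 0 (min t T), ‖u s‖ ^ 2 :=
      mul_nonneg (by positivity) (intervalIntegral.integral_nonneg hmem.1 fun s _ ↦ sq_nonneg _)
    have h6 := hest _ hmem
    exact (le_of_add_le_of_nonneg_left h6 h5).trans (le_mul_of_one_le_left hKd hα1)
  exact max_le hL2 hsup

/-- Extension by continuity, phrased for graphs: the bound applied to differences makes the second
components Cauchy when the first ones converge. -/
theorem exists_mem_closure_of_dense_of_bound {X Y : Type*} [NormedAddCommGroup X]
    [NormedSpace ℝ X] [NormedAddCommGroup Y] [NormedSpace ℝ Y] [CompleteSpace Y]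
    (S : Submodule ℝ (X × Y)) (hS : (S.map (LinearMap.fst ℝ X Y)).topologicalClosure = ⊤) {C : ℝ}
    (hC0 : 0 ≤ C) (hC : ∀ x ∈ S, ‖x.2‖ ≤ C * ‖x.1‖) (d : X) :
    ∃ y : Y, (d, y) ∈ closure (S : Set (X × Y)) := by
  have hd : d ∈ closure (S.map (LinearMap.fst ℝ X Y) : Set X) := by
    rw [← Submodule.topologicalClosure_coe, hS]
    trivial
  obtain ⟨s, hs, hsd⟩ := mem_closure_iff_seq_limit.1 hd
  choose x hx hxs using hs
  have hcauchy : CauchySeq fun n ↦ (x n).2 := by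
    refine Metric.cauchySeq_iff'.2 fun ε hε ↦ ?_
    -- Dividing by `C + 1` rather than `C` allows `C = 0`.
    obtain ⟨N, hN⟩ := Metric.cauchySeq_iff'.1 hsd.cauchySeq (ε / (C + 1)) (by positivity)
    refine ⟨N, fun n hn ↦ ?_⟩
    have h1 := hC _ (S.sub_mem (hx n) (hx N))
    have h2 : ‖(x n - x N).1‖ = dist (s n) (s N) := by
      rw [dist_eq_norm, ← hxs n, ← hxs N]; rfl
    rw [h2] at h1
    calc dist (x n).2 (x N).2 ≤ C * dist (s n) (s N) := by rw [dist_eq_norm]; exact h1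
      _ ≤ (C + 1) * dist (s n) (s N) :=
        mul_le_mul_of_nonneg_right (by linarith) dist_nonneg
      _ < (C + 1) * (ε / (C + 1)) := mul_lt_mul_of_pos_left (hN n hn) (by positivity)
      _ = ε := by field_simp
  obtain ⟨y, hy⟩ := cauchySeq_tendsto_of_complete hcauchy
  refine ⟨y, mem_closure_iff_seq_limit.2 ⟨x, hx, ?_⟩⟩
  have h3 : (fun n ↦ (x n).1) = s := funext hxs
  exact Prod.tendsto_iff _ _ |>.2 ⟨by simpa [h3] using hsd, hy⟩

end Existence

/-! ### Passage to the limit. -/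

section Solution

variable {V H W : Type*} [NormedAddCommGroup V] [NormedSpace ℝ V]
  [NormedAddCommGroup H] [InnerProductSpace ℝ H] [NormedAddCommGroup W] [InnerProductSpace ℝ W]
  {ι : V →L[ℝ] H} {A : V →L[ℝ] StrongDual ℝ V} {R : W ≃L[ℝ] StrongDual ℝ V} {T : ℝ}

/-- In this form `u'` no longer occurs, so each term is continuous in the $L^2$ norms and the
identity survives closure. -/
theorem integral_deriv_smul_eq_of_mem_classicalGraph (hT : 0 < T)
    {x : WithLp 2 (H × L2Time T W) × L2Time T V × BoundedContinuousFunction ℝ H}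
    (hx : x ∈ classicalGraph ι A R T) {φ : ℝ → ℝ} (hφ : ContDiff ℝ ∞ φ)
    (hφs : tsupport φ ⊆ Ioo 0 T) :
    ∫ t, deriv φ t • (pivotToDual ι).comp ι (x.2.1 t) ∂timeMeasure T =
      -(∫ t, φ t • A (x.2.1 t) ∂timeMeasure T +
        ∫ t, φ t • (R : W →L[ℝ] StrongDual ℝ V) (x.1.snd t) ∂timeMeasure T) := by
  obtain ⟨u, u', hc, hd, -, h2, h3, -⟩ := hx
  have huc : Continuous u := continuous_iff_continuousAt.2 fun t ↦ (hd t).continuousAt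
  have hdφ : Continuous (deriv φ) := hφ.continuous_deriv (by simp)
  have hφc := hφ.continuous
  have hφ0 : φ 0 = 0 := image_eq_zero_of_notMem_tsupport fun h ↦ lt_irrefl _ (hφs h).1
  have hφT : φ T = 0 := image_eq_zero_of_notMem_tsupport fun h ↦ lt_irrefl _ (hφs h).2
  have hIcc : ∀ g : ℝ → StrongDual ℝ V, ∫ t, g t ∂timeMeasure T = ∫ t in (0)..T, g t := fun g ↦ by
    rw [intervalIntegral.integral_of_le hT.le, integral_Icc_eq_integral_Ioc]
  set P := (pivotToDual ι).comp ι with hP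
  have e1 : ∫ t, deriv φ t • P (x.2.1 t) ∂timeMeasure T = ∫ t in (0)..T, deriv φ t • P (u t) := by
    rw [← hIcc]
    refine integral_congr_ae ?_
    filter_upwards [h3] with t ht
    rw [ht]
  have e2 : ∫ t, φ t • A (x.2.1 t) ∂timeMeasure T = ∫ t in (0)..T, φ t • A (u t) := by
    rw [← hIcc]
    refine integral_congr_ae ?_
    filter_upwards [h3] with t ht
    rw [ht]
  have e3 : ∫ t, φ t • (R : W →L[ℝ] StrongDual ℝ V) (x.1.snd t) ∂timeMeasure T =
      ∫ t in (0)..T, φ t • (P (u' t) - A (u t)) := by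
    rw [← hIcc]
    refine integral_congr_ae ?_
    filter_upwards [h2] with t ht
    exact congrArg (φ t • ·) ht
  have e4 := intervalIntegral.integral_smul_deriv_eq_deriv_smul (u := φ) (u' := deriv φ)
    (v := fun t ↦ P (u t)) (v' := fun t ↦ P (u' t)) (a := 0) (b := T)
    (fun t _ ↦ ((hφ.differentiable (by simp)) t).hasDerivAt)
    (fun t _ ↦ P.hasFDerivAt.comp_hasDerivAt t (hd t))
    (hdφ.intervalIntegrable _ _) (Continuous.intervalIntegrable (by fun_prop) _ _)
  rw [hφ0, hφT, zero_smul, zero_smul, sub_zero, zero_sub] at e4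
  rw [e1, e2, e3, ← intervalIntegral.integral_add
    (Continuous.intervalIntegrable (by fun_prop) _ _)
    (Continuous.intervalIntegrable (by fun_prop) _ _)]
  simp only [← smul_add, add_sub_cancel]
  rw [e4, neg_neg]

theorem integral_deriv_smul_eq_of_mem_closure (hT : 0 < T)
    {x : WithLp 2 (H × L2Time T W) × L2Time T V × BoundedContinuousFunction ℝ H}
    (hx : x ∈ closure (classicalGraph ι A R T : Set _)) {φ : ℝ → ℝ} (hφ : ContDiff ℝ ∞ φ)
    (hφs : tsupport φ ⊆ Ioo 0 T) :
    ∫ t, deriv φ t • (pivotToDual ι).comp ι (x.2.1 t) ∂timeMeasure T =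
      -(∫ t, φ t • A (x.2.1 t) ∂timeMeasure T +
        ∫ t, φ t • (R : W →L[ℝ] StrongDual ℝ V) (x.1.snd t) ∂timeMeasure T) := by
  have hcu : Continuous fun x : WithLp 2 (H × L2Time T W) × L2Time T V ×
      BoundedContinuousFunction ℝ H ↦ x.2.1 := continuous_fst.comp continuous_snd
  have hcb : Continuous fun x : WithLp 2 (H × L2Time T W) × L2Time T V ×
      BoundedContinuousFunction ℝ H ↦ x.1.snd := (WithLp.continuous_snd _ _ _).comp continuous_fst
  refine closure_minimal (t := {x | _ = _}) (fun y hy ↦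
    integral_deriv_smul_eq_of_mem_classicalGraph hT hy hφ hφs) (isClosed_eq ?_ ?_) hx
  · exact (continuous_integral_smul_L2Time _ T (hφ.continuous_deriv (by simp))).comp hcu
  · exact (((continuous_integral_smul_L2Time A T hφ.continuous).comp hcu).add
      ((continuous_integral_smul_L2Time _ T hφ.continuous).comp hcb)).neg

/-- Agreement of `ι u` with the continuous component in $L^2$, and the value of that component at
`0`, are closed conditions; uniform convergence is what keeps the limit continuous. -/
theorem isContinuousFrom_of_mem_closure (hT : 0 < T)
    {x : WithLp 2 (H × L2Time T W) × L2Time T V × BoundedContinuousFunction ℝ H}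
    (hx : x ∈ closure (classicalGraph ι A R T : Set _)) :
    IsContinuousFrom ι T x.1.fst x.2.1 := by
  have hL2 : ι.compLpL 2 (timeMeasure T) x.2.1 =
      BoundedContinuousFunction.toLp 2 (timeMeasure T) ℝ x.2.2 := by
    refine closure_minimal (t := {x | _ = _}) ?_ (isClosed_eq
      ((ContinuousLinearMap.continuous _).comp (continuous_fst.comp continuous_snd))
      ((ContinuousLinearMap.continuous _).comp (continuous_snd.comp continuous_snd))) hx
    rintro y ⟨u, u', -, -, -, -, h3, h4⟩
    refine Lp.ext ?_
    filter_upwards [ι.coeFn_compLpL y.2.1, h3, ae_restrict_mem measurableSet_Icc,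
      BoundedContinuousFunction.coeFn_toLp 2 (timeMeasure T) ℝ y.2.2] with t e1 e2 e3 e4
    refine (e1.trans ?_).trans e4.symm
    rw [e2, h4, min_eq_left e3.2, max_eq_right e3.1]
  have h0 : x.2.2 0 = x.1.fst := by
    refine closure_minimal (t := {x | _ = _}) ?_ (isClosed_eq
      ((BoundedContinuousFunction.evalCLM ℝ (0 : ℝ)).continuous.comp
        (continuous_snd.comp continuous_snd))
      ((WithLp.continuous_fst _ _ _).comp continuous_fst)) hx
    rintro y ⟨u, u', -, -, h1, -, -, h4⟩
    change y.2.2 0 = y.1.fst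
    rw [h1, h4, min_eq_left hT.le, max_self]
  refine ⟨x.2.2, x.2.2.continuous.continuousOn, ?_, h0⟩
  filter_upwards [ι.coeFn_compLpL (p := 2) x.2.1,
    BoundedContinuousFunction.coeFn_toLp 2 (timeMeasure T) ℝ x.2.2] with t e1 e2
  rw [← e1, hL2, e2]

end Solution

/-! ### Existence and the final statement. -/

theorem exists_isWeakSolution {V H : Type*} [NormedAddCommGroup V] [NormedSpace ℝ V]
    [CompleteSpace V] [NormedAddCommGroup H] [InnerProductSpace ℝ H] [CompleteSpace H]
    {ι : V →L[ℝ] H} (hι : IsGelfandEmbedding ι) {A : V →L[ℝ] StrongDual ℝ V}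
    (hA : IsCoerciveOperator ι A) {T : ℝ} (hT : 0 < T) (u₀ : H) (B : L2Time T (StrongDual ℝ V)) :
    ∃ u : L2Time T V, IsWeakSolution ι A T B u ∧ IsContinuousFrom ι T u₀ u := by
  obtain ⟨W, _, _, _, e, R, hR⟩ := hA.exists_riesz
  obtain ⟨C, hC0, hC⟩ := exists_norm_snd_le_of_mem_classicalGraph hA R hT
  -- The source is transported to the Hilbert space `W`, where the density result lives.
  set b : L2Time T W := (R.symm : StrongDual ℝ V →L[ℝ] W).compLp B with hb
  obtain ⟨⟨u, w⟩, hx⟩ := exists_mem_closure_of_dense_of_bound (classicalGraph ι A R T)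
    (dense_map_fst_classicalGraph hι hA hR hT) hC0 hC (WithLp.toLp 2 (u₀, b))
  have hui := integrable_of_L2Time u
  have hdu : ∀ᵐ t ∂timeMeasure T, (A.compLp u + B : L2Time T (StrongDual ℝ V)) t =
      A (u t) + B t := by
    filter_upwards [Lp.coeFn_add (A.compLp u) B, A.coeFn_compLp u] with t e1 e2
    rw [e1, Pi.add_apply, e2]
  refine ⟨u, ⟨A.compLp u + B, ⟨((pivotToDual ι).comp ι).integrable_comp hui,
    integrable_of_L2Time _, fun φ hφ _ hφs ↦ ?_⟩, ?_⟩, isContinuousFrom_of_mem_closure hT hx⟩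
  · refine (integral_deriv_smul_eq_of_mem_closure hT hx hφ hφs).trans (congrArg Neg.neg ?_)
    have hφc := hφ.continuous.continuousOn (s := Icc 0 T)
    have h1 : ∫ t, φ t • (R : W →L[ℝ] StrongDual ℝ V) (b t) ∂timeMeasure T =
        ∫ t, φ t • B t ∂timeMeasure T := integral_congr_ae (by
      filter_upwards [(R.symm : StrongDual ℝ V →L[ℝ] W).coeFn_compLp B] with t e1
      rw [hb, e1]
      simp)
    refine (congrArg (_ + ·) h1).trans ?_
    rw [← integral_add
      (IntegrableOn.continuousOn_smul (A.integrable_comp hui) hφc isCompact_Icc)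
      (IntegrableOn.continuousOn_smul (integrable_of_L2Time B) hφc isCompact_Icc)]
    refine integral_congr_ae ?_
    filter_upwards [hdu] with t e1
    rw [e1, smul_add]
  · filter_upwards [hdu] with t e1 v
    rw [e1, add_apply]

theorem mainTheorem3
    {V : Type*} [NormedAddCommGroup V] [NormedSpace ℝ V] [CompleteSpace V]
    [TopologicalSpace.SeparableSpace V] (hV : IsReflexiveSpace V)
    {H : Type*} [NormedAddCommGroup H] [InnerProductSpace ℝ H] [CompleteSpace H]
    [TopologicalSpace.SeparableSpace H]
    (ι : V →L[ℝ] H) (hι : IsGelfandEmbedding ι)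
    (A : V →L[ℝ] StrongDual ℝ V) (hA : IsCoerciveOperator ι A)
    (T : ℝ) (hT : 0 < T) (u₀ : H) (B : L2Time T (StrongDual ℝ V)) :
    ∃! u : L2Time T V, IsWeakSolution ι A T B u ∧ IsContinuousFrom ι T u₀ u := by
  obtain ⟨u, hu, hu0⟩ := exists_isWeakSolution hι hA hT u₀ B
  refine ⟨u, ⟨hu, hu0⟩, fun v ⟨hv, hv0⟩ ↦ sub_eq_zero.1 ?_⟩
  have h1 := hv.sub hu
  have h2 := hv0.sub hu0
  rw [sub_self] at h1 h2
  exact eq_zero_of_isWeakSolution_zero hι hA hT h1 h2
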